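/- All graphs are finite and simple. Fix one of the two matrix representations of graphs, adjacency or Laplacian; the spectrum of a graph is the multiset of eigenvalues of this matrix, and two graphs are cospectral if they have the same spectrum and are not isomorphic. A graph $A$ is a (Cartesian) factor of $G$ if $G\cong A\square K$ for some graph $K$, where $\square$ is the Cartesian product; a graph with more than one vertex is Cartesian prime if each of its factors with more than one vertex is isomorphic to the graph itself; two graphs are coprime if no Cartesian prime graph is a factor of both. Theorem 2 (thm:loosen). Let $\mathcal G=\{G_1,\dots,G_p\}$ and $\mathcal H=\{H_1,\dots,H_q\}$ be families of connected, mutually cospectral graphs such that the spectrum of every $G_i$ differs from the spectrum of every $H_j$, and put $F_{ij}=G_i\square H_j$ for $1\le i\le p$, $1\le j\le q$. Suppose that some $G_i$ and some $H_j$ are coprime. Then the largest mutually non-isomorphic subfamily of $\mathcal F=\{F_{ij}\}$ has size at least $p+q-1$. More precisely, whenever $G_a$ and $H_b$ are coprime, the row and the column of the array $(F_{ij})$ through $(a,b)$, that is, $\{F_{ij}: i=a \text{ or } j=b\}$, form a family of $p+q-1$ connected, mutually cospectral (in particular pairwise non-isomorphic) graphs. -/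

import Mathlib

namespace CospectralProduct

/-- The two matrix representations of a graph under consideration. -/
inductive MatrixKind where
  | adjacency
  | laplacian

/-- The real matrix of the given kind (adjacency or Laplacian) of a finite simple graph. -/
noncomputable def graphMatrix (M : MatrixKind) {V : Type*} [Fintype V] (G : SimpleGraph V) :
    open Classical in Matrix V V ℝ :=
  open Classical in
  match M with
  | MatrixKind.adjacency => G.adjMatrix ℝ
  | MatrixKind.laplacian => G.lapMatrix ℝ

/-- The spectrum of a finite graph with respect to the chosen matrix: the multiset of its
eigenvalues, counted with multiplicity. The matrix is real symmetric, so all its eigenvalues are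
real and the roots in `ℝ` of the characteristic polynomial are all of them. -/
noncomputable def graphSpectrum (M : MatrixKind) {V : Type*} [Fintype V] (G : SimpleGraph V) :
    Multiset ℝ :=
  open Classical in (graphMatrix M G).charpoly.roots

/-- Two graphs are isomorphic. -/
def Isomorphic {V W : Type*} (G : SimpleGraph V) (H : SimpleGraph W) : Prop :=
  Nonempty (G ≃g H)

/-- Two graphs are cospectral with respect to the chosen matrix: they have the same spectrum and
are not isomorphic. -/
def Cospectral (M : MatrixKind) {V W : Type*} [Fintype V] [Fintype W]
    (G : SimpleGraph V) (H : SimpleGraph W) : Prop :=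
  graphSpectrum M G = graphSpectrum M H ∧ ¬ Isomorphic G H

/-- `A` is a Cartesian factor of the finite graph `G`: `G ≅ A □ K` for some finite graph `K`.
Every finite graph is isomorphic to one on some `Fin n`, so it suffices to let `K` range over
those. -/
def IsCartesianFactor {V W : Type*} (A : SimpleGraph V) (G : SimpleGraph W) : Prop :=
  ∃ (n : ℕ) (K : SimpleGraph (Fin n)), Isomorphic G (A □ K)

/-- A finite graph is Cartesian prime if it is nontrivial (has more than one vertex) and each of
its nontrivial factors is the graph itself, up to isomorphism. -/
def IsCartesianPrime {V : Type*} (P : SimpleGraph V) : Prop :=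
  Nontrivial V ∧
    ∀ (n : ℕ) (A : SimpleGraph (Fin n)), 1 < n → IsCartesianFactor A P → Isomorphic A P

/-- Two finite graphs are coprime if no Cartesian prime graph is a factor of both. -/
def CartesianCoprime {V W : Type*} (G : SimpleGraph V) (H : SimpleGraph W) : Prop :=
  ∀ (n : ℕ) (P : SimpleGraph (Fin n)), IsCartesianPrime P →
    ¬ (IsCartesianFactor P G ∧ IsCartesianFactor P H)

end CospectralProduct

/-!
The proof rests on the refinement property of the Cartesian product of connected graphs: an
isomorphism `A □ B ≃g C □ D` comes from factorizations `A ≅ X □ Y`, `B ≅ Z □ U`, `C ≅ X □ Z`,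
`D ≅ Y □ U` (`exists_refinement`). It has a short metric proof. Distances in a product add up, so
every fibre `C × {d}` is geodesically convex, and `(a, b')` lies on a geodesic from `(a, b)` to
`(a', b')`. Hence the preimage of a fibre `C × {d}` under the isomorphism is a combinatorial box,
the product of its two projections (`snd_apply_mk_eq`), and this factors `C`; the other three
factorizations arise in the same way, and the isomorphism identifies the pieces in pairs.

Refinement gives cancellation for connected graphs by induction on the number of vertices
(`isomorphic_of_boxProd_left`): two distinct products in one row or one column of the array are
not isomorphic. A product of the row through `(a, b)` and one of the column are compared by
refining `G a □ H j ≅ G i □ H b`. Coprimality of `G a` and `H b` forces their common part `Y` to be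
a single vertex, so that `G i ≅ G a □ Z`; since `G a` and `G i` have equally many vertices, `Z` is
a single vertex too and `G i ≅ G a` (`CartesianCoprime.isomorphic_of_boxProd`).

Finally the matrix of a product is the Kronecker sum of the matrices of its factors, in the
adjacency and in the Laplacian case, so its spectrum consists of all sums of an eigenvalue of one
factor and an eigenvalue of the other (`graphSpectrum_boxProd`). All the products in the array
therefore have the same spectrum.
-/

namespace CospectralProduct

open SimpleGraph
open scoped Kronecker

/-! ### Isomorphisms of Cartesian products -/

section Iso

variable {α β γ δ : Type*} {A : SimpleGraph α} {B : SimpleGraph β} {C : SimpleGraph γ}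
  {D : SimpleGraph δ}

lemma Isomorphic.refl (A : SimpleGraph α) : Isomorphic A A := ⟨Iso.refl⟩

lemma Isomorphic.symm (h : Isomorphic A B) : Isomorphic B A := h.map Iso.symm

lemma Isomorphic.trans (h : Isomorphic A B) (h' : Isomorphic B C) : Isomorphic A C :=
  ⟨h.some.trans h'.some⟩

lemma Isomorphic.boxProd (h : Isomorphic A C) (h' : Isomorphic B D) :
    Isomorphic (A □ B) (C □ D) := by
  obtain ⟨e⟩ := h
  obtain ⟨f⟩ := h'
  refine ⟨⟨e.toEquiv.prodCongr f.toEquiv, ?_⟩⟩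
  rintro ⟨a, b⟩ ⟨a', b'⟩
  simp only [boxProd_adj, Equiv.prodCongr_apply, Prod.map_apply, EmbeddingLike.apply_eq_iff_eq]
  exact or_congr (and_congr_left' e.map_adj_iff) (and_congr_left' f.map_adj_iff)

lemma Isomorphic.boxProd_comm (A : SimpleGraph α) (B : SimpleGraph β) :
    Isomorphic (A □ B) (B □ A) := ⟨boxProdComm A B⟩

lemma Isomorphic.boxProd_assoc (A : SimpleGraph α) (B : SimpleGraph β) (C : SimpleGraph γ) :
    Isomorphic ((A □ B) □ C) (A □ (B □ C)) := ⟨boxProdAssoc A B C⟩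

lemma Isomorphic.natCard_eq (h : Isomorphic A B) : Nat.card α = Nat.card β :=
  Nat.card_congr h.some.toEquiv

lemma Isomorphic.connected (h : Isomorphic A B) (hA : A.Connected) : B.Connected :=
  h.some.connected_iff.1 hA

/-- A graph with one vertex is neutral for the Cartesian product. -/
lemma Isomorphic.boxProd_of_natCard_eq_one (A : SimpleGraph α) (B : SimpleGraph β)
    (h : Nat.card β = 1) : Isomorphic (A □ B) A := by
  obtain ⟨_, _⟩ := Nat.card_eq_one_iff_unique.1 h
  obtain ⟨_⟩ := nonempty_unique β
  refine ⟨⟨Equiv.prodUnique α β, ?_⟩⟩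
  rintro ⟨a, b⟩ ⟨a', b'⟩
  obtain rfl := Subsingleton.elim b b'
  simp

lemma isomorphic_of_natCard_eq_one (A : SimpleGraph α) (B : SimpleGraph β)
    (hα : Nat.card α = 1) (hβ : Nat.card β = 1) : Isomorphic A B :=
  (Isomorphic.boxProd_of_natCard_eq_one A B hβ).symm.trans <|
    (Isomorphic.boxProd_comm A B).trans (Isomorphic.boxProd_of_natCard_eq_one B A hα)

/-- Every finite graph is isomorphic to a graph on some `Fin n`. -/
lemma exists_isomorphic_fin [Finite α] (A : SimpleGraph α) :
    ∃ K : SimpleGraph (Fin (Nat.card α)), Isomorphic K A :=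
  ⟨A.comap (Finite.equivFin α).symm, ⟨Iso.comap (Finite.equivFin α).symm A⟩⟩

end Iso

/-! ### Convexity of fibres -/

section Refinement

variable {α β γ δ : Type*} {A : SimpleGraph α} {B : SimpleGraph β} {C : SimpleGraph γ}
  {D : SimpleGraph δ}

lemma dist_boxProd (hA : A.Connected) (hB : B.Connected) (x y : α × β) :
    (A □ B).dist x y = A.dist x.1 y.1 + B.dist x.2 y.2 := by
  have h := edist_boxProd (G := A) (H := B) x y
  rw [← ((hA.boxProd hB) x y).coe_dist_eq_edist, ← (hA x.1 y.1).coe_dist_eq_edist,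
    ← (hB x.2 y.2).coe_dist_eq_edist] at h
  exact_mod_cast h

lemma dist_apply_le (φ : A →g B) (hA : A.Connected) (x y : α) :
    B.dist (φ x) (φ y) ≤ A.dist x y := by
  obtain ⟨w, hw⟩ := hA.exists_walk_length_eq_dist x y
  rw [← hw, ← w.length_map φ]
  exact dist_le _

lemma dist_iso_apply (φ : A ≃g B) (hA : A.Connected) (x y : α) :
    B.dist (φ x) (φ y) = A.dist x y := by
  refine le_antisymm (dist_apply_le φ.toHom hA x y) ?_
  simpa using dist_apply_le φ.symm.toHom (φ.connected_iff.1 hA) (φ x) (φ y)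

/-- The preimage of a fibre `C × {d}` under an isomorphism `A □ B ≃g C □ D` is a box: with `(a, b)`
and `(a', b')` it contains the corner `(a, b')`, which lies on a geodesic between them. -/
lemma snd_apply_mk_eq (φ : (A □ B) ≃g (C □ D)) (h : (A □ B).Connected) {d : δ} {a a' : α} {b b' : β}
    (h₁ : (φ (a, b)).2 = d) (h₂ : (φ (a', b')).2 = d) : (φ (a, b')).2 = d := by
  have h' := φ.connected_iff.1 h
  have hC := h'.ofBoxProdLeft
  have hD := h'.ofBoxProdRight
  have key : (A □ B).dist (a, b) (a, b') + (A □ B).dist (a, b') (a', b') =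
      (A □ B).dist (a, b) (a', b') := by
    simp only [dist_boxProd h.ofBoxProdLeft h.ofBoxProdRight, dist_self]
    omega
  simp only [← dist_iso_apply φ h, dist_boxProd hC hD, h₁, h₂, dist_self] at key
  have tri := hC.dist_triangle (u := (φ (a, b)).1) (v := (φ (a, b')).1) (w := (φ (a', b')).1)
  exact (hD.dist_eq_zero_iff.1 (by omega : D.dist d (φ (a, b')).2 = 0)).symm

/-! ### Common refinement of two factorizations -/

/-- The vertices `a` of `A` for which the isomorphism `φ : A □ B ≃g C □ D` maps `(a, b)` into the
fibre `C × {d}`. They span the part of `A` along `b` that corresponds to a part of `C`. -/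
def slice (φ : (A □ B) ≃g (C □ D)) (b : β) (d : δ) : Set α := {a | (φ (a, b)).2 = d}

/-- The preimage of the fibre `C × {d}` is a box, which factors `C` into the two sides of that
box. -/
lemma isomorphic_slice_boxProd (φ : (A □ B) ≃g (C □ D)) (h : (A □ B).Connected) {a : α} {b : β} {d : δ}
    (hd : (φ (a, b)).2 = d) :
    Isomorphic C (A.induce (slice φ b d) □ B.induce (slice ((boxProdComm B A).trans φ) a d)) := by
  have hφ (c : γ) : (φ (φ.symm (c, d))).2 = d := by simp
  refine ⟨⟨⟨fun c => (⟨(φ.symm (c, d)).1, snd_apply_mk_eq φ h (hφ c) hd⟩,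
    ⟨(φ.symm (c, d)).2, snd_apply_mk_eq φ h hd (hφ c)⟩), fun x => (φ (x.1, x.2)).1, ?_, ?_⟩, ?_⟩⟩
  · intro c
    simp
  · rintro ⟨⟨x, hx⟩, ⟨y, hy⟩⟩
    have e : ((φ (x, y)).1, d) = φ (x, y) :=
      Prod.ext rfl (snd_apply_mk_eq φ h hx hy).symm
    simp [e]
  · intro c c'
    rw [← boxProd_adj_left (G := C) (H := D) (b := d), ← φ.symm.map_adj_iff, boxProd_adj,
      boxProd_adj]
    simp [Subtype.ext_iff]

/-- The slice of `A` and the slice of `C` that `φ` matches with each other are isomorphic. -/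
lemma isomorphic_slice_symm (φ : (A □ B) ≃g (C □ D)) (b : β) (d : δ) :
    Isomorphic (A.induce (slice φ b d)) (C.induce (slice φ.symm d b)) := by
  have e₁ (a : slice φ b d) : ((φ (a, b)).1, d) = φ (a, b) := Prod.ext rfl a.2.symm
  have e₂ (c : slice φ.symm d b) : ((φ.symm (c, d)).1, b) = φ.symm (c, d) := Prod.ext rfl c.2.symm
  refine ⟨⟨⟨fun a => ⟨(φ (a, b)).1, ?_⟩, fun c => ⟨(φ.symm (c, d)).1, ?_⟩, ?_, ?_⟩, ?_⟩⟩
  · simp [slice, e₁]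
  · simp [slice, e₂]
  · intro a
    simp [e₁]
  · intro c
    simp [e₂]
  · intro a a'
    simp only [Equiv.coe_fn_mk, comap_adj, Function.Embedding.subtype_apply]
    rw [← boxProd_adj_left (H := D) (b := d), e₁, e₁, φ.map_adj_iff, boxProd_adj_left]

/-- **Refinement**: two factorizations of a connected graph into two factors have a common
refinement into four factors. -/
theorem exists_refinement (h : Isomorphic (A □ B) (C □ D)) (hconn : (A □ B).Connected) :
    ∃ (X : Set α) (Y : Set δ) (Z U : Set β),
      Isomorphic A (A.induce X □ D.induce Y) ∧ Isomorphic B (B.induce Z □ B.induce U) ∧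
      Isomorphic C (A.induce X □ B.induce Z) ∧ Isomorphic D (D.induce Y □ B.induce U) := by
  obtain ⟨φ⟩ := h
  have hconn' := φ.connected_iff.1 hconn
  have : Nonempty (α × β) := hconn.nonempty
  obtain ⟨a, b⟩ : α × β := Classical.arbitrary _
  obtain ⟨⟨c, d⟩, hcd⟩ : ∃ x, φ (a, b) = x := ⟨_, rfl⟩
  have hab : φ.symm (c, d) = (a, b) := by rw [← hcd]; simp
  let ψ : (A □ B) ≃g (D □ C) := φ.trans (boxProdComm C D)
  let φ' : (B □ A) ≃g (C □ D) := (boxProdComm B A).trans φ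
  let ψ' : (B □ A) ≃g (D □ C) := (boxProdComm B A).trans ψ
  refine ⟨slice φ b d, slice ψ.symm c b, slice φ' a d, slice ψ' a c, ?_, ?_, ?_, ?_⟩
  · exact (isomorphic_slice_boxProd φ.symm hconn' (a := c) (b := d) (by rw [hab])).trans
      ((isomorphic_slice_symm φ b d).symm.boxProd (.refl _))
  · exact (isomorphic_slice_boxProd φ'.symm hconn' (a := c) (b := d) (d := a)
      (congrArg Prod.fst hab)).trans
      ((isomorphic_slice_symm φ' a d).symm.boxProd (isomorphic_slice_symm ψ' a c).symm)
  · exact isomorphic_slice_boxProd φ hconn (by rw [hcd])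
  · exact (isomorphic_slice_boxProd ψ hconn (a := a) (b := b) (d := c)
      (congrArg Prod.fst hcd)).trans ((isomorphic_slice_symm ψ b c).boxProd (.refl _))

end Refinement

/-! ### Cancellation -/

universe u v

/-- Connected finite graphs can be cancelled from Cartesian products. -/
theorem isomorphic_of_boxProd_left {α : Type u} {β β' : Type v} [Finite α] [Finite β] [Finite β']
    {A : SimpleGraph α} {B : SimpleGraph β} {B' : SimpleGraph β'}
    (h : Isomorphic (A □ B) (A □ B')) (hconn : (A □ B).Connected) : Isomorphic B B' := by
  induction hn : Nat.card α * Nat.card β using Nat.strong_induction_on generalizing α β β' with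
  | _ n ih =>
    have hα : 0 < Nat.card α := @Nat.card_pos _ hconn.ofBoxProdLeft.nonempty _
    have hβ : 0 < Nat.card β := @Nat.card_pos _ hconn.ofBoxProdRight.nonempty _
    have hcard := h.natCard_eq
    rw [Nat.card_prod, Nat.card_prod] at hcard
    have hββ' : Nat.card β = Nat.card β' := Nat.eq_of_mul_eq_mul_left hα hcard
    by_cases h1 : Nat.card β = 1
    · exact isomorphic_of_natCard_eq_one B B' h1 (hββ' ▸ h1)
    -- Refining `A □ B ≅ A □ B'` splits `A` in two ways with a common factor `X`; the
    -- cancellation of `X` is an instance of the claim with `Nat.card α` vertices.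
    obtain ⟨X, Y, Z, U, hA, hB, hA', hB'⟩ := exists_refinement h hconn
    have hXY := hA.natCard_eq
    rw [Nat.card_prod] at hXY
    have hYZ := ih (Nat.card X * Nat.card Y)
      (by rw [← hXY, ← hn]; nlinarith [show 2 ≤ Nat.card β by omega])
      (hA.symm.trans hA') (hA.connected hconn.ofBoxProdLeft) rfl
    exact hB.trans ((hYZ.symm.boxProd (.refl _)).trans hB'.symm)

/-! ### Prime factors and coprimality -/

section Coprime

variable {α β γ δ : Type*} {A : SimpleGraph α} {B : SimpleGraph β} {C : SimpleGraph γ}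
  {D : SimpleGraph δ}

lemma isCartesianFactor_of_isomorphic [Finite β] (h : Isomorphic C (A □ B)) :
    IsCartesianFactor A C := by
  obtain ⟨K, hK⟩ := exists_isomorphic_fin B
  exact ⟨_, K, h.trans ((Isomorphic.refl A).boxProd hK.symm)⟩

lemma IsCartesianFactor.trans (h : IsCartesianFactor A B) (h' : IsCartesianFactor B C) :
    IsCartesianFactor A C := by
  obtain ⟨_, K, hK⟩ := h
  obtain ⟨_, L, hL⟩ := h'
  exact isCartesianFactor_of_isomorphic <|
    (hL.trans (hK.boxProd (.refl L))).trans (Isomorphic.boxProd_assoc A K L)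

lemma isCartesianFactor_refl (A : SimpleGraph α) : IsCartesianFactor A A :=
  ⟨1, ⊥, (Isomorphic.boxProd_of_natCard_eq_one A ⊥ (by simp)).symm⟩

/-- Every nontrivial finite graph has a Cartesian prime factor. -/
lemma exists_isCartesianPrime_factor {n : ℕ} (hn : 1 < n) (A : SimpleGraph (Fin n)) :
    ∃ (m : ℕ) (P : SimpleGraph (Fin m)), IsCartesianPrime P ∧ IsCartesianFactor P A := by
  induction n using Nat.strong_induction_on with
  | _ n ih =>
    by_cases hA : IsCartesianPrime A
    · exact ⟨n, A, hA, isCartesianFactor_refl A⟩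
    have : Nontrivial (Fin n) := Fin.nontrivial_iff_two_le.2 hn
    simp only [IsCartesianPrime, not_and, not_forall] at hA
    obtain ⟨m, B, hm, ⟨k, K, hK⟩, hBA⟩ := hA this
    have hcard := hK.natCard_eq
    simp only [Nat.card_prod, Nat.card_fin] at hcard
    have hk1 : k ≠ 1 := by
      rintro rfl
      exact hBA (hK.trans (Isomorphic.boxProd_of_natCard_eq_one B K (by simp))).symm
    have hk0 : k ≠ 0 := by
      rintro rfl
      omega
    obtain ⟨l, P, hP, hPB⟩ := ih m (by rw [hcard]; nlinarith [show 2 ≤ k by omega]) hm B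
    exact ⟨l, P, hP, hPB.trans ⟨k, K, hK⟩⟩

lemma CartesianCoprime.natCard_le_one [Finite γ] (h : CartesianCoprime A B)
    (hA : IsCartesianFactor C A) (hB : IsCartesianFactor C B) : Nat.card γ ≤ 1 := by
  by_contra! hlt
  obtain ⟨K, hK⟩ := exists_isomorphic_fin C
  obtain ⟨m, P, hP, hPK⟩ := exists_isCartesianPrime_factor hlt K
  have hPC : IsCartesianFactor P C := by
    obtain ⟨l, L, hL⟩ := hPK
    exact ⟨l, L, hK.symm.trans hL⟩
  exact h m P hP ⟨hPC.trans hA, hPC.trans hB⟩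

/-- If `A` and `D` are coprime, then `A □ B ≅ C □ D` makes `A` a factor of `C`; when these two have
equally many vertices, they are isomorphic. -/
theorem CartesianCoprime.isomorphic_of_boxProd [Finite α] [Finite β] [Finite δ]
    (hcop : CartesianCoprime A D) (h : Isomorphic (A □ B) (C □ D)) (hconn : (A □ B).Connected)
    (hcard : Nat.card α = Nat.card γ) : Isomorphic A C := by
  obtain ⟨X, Y, Z, U, hA, -, hC, hD⟩ := exists_refinement h hconn
  have hα : 0 < Nat.card α := @Nat.card_pos _ hconn.ofBoxProdLeft.nonempty _
  have hY := hcop.natCard_le_one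
    (isCartesianFactor_of_isomorphic (hA.trans (Isomorphic.boxProd_comm _ _)))
    (isCartesianFactor_of_isomorphic hD)
  have hXY := hA.natCard_eq
  have hXZ := hC.natCard_eq
  rw [Nat.card_prod] at hXY hXZ
  have hXpos : 0 < Nat.card X := Nat.pos_of_ne_zero fun h0 => by simp [h0] at hXY; omega
  have hY1 : Nat.card Y = 1 := by
    have : Nat.card Y ≠ 0 := fun h0 => by simp [h0] at hXY; omega
    omega
  have hZ1 : Nat.card Z = 1 :=
    (Nat.eq_of_mul_eq_mul_left hXpos (by rw [← hXY, ← hXZ, hcard])).trans hY1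
  exact (hA.trans (Isomorphic.boxProd_of_natCard_eq_one _ _ hY1)).trans
    (hC.trans (Isomorphic.boxProd_of_natCard_eq_one _ _ hZ1)).symm

end Coprime

/-! ### Spectra of Cartesian products -/

section Spectrum

variable {m n : Type*} [Fintype m] [Fintype n]

/-- The eigenvalues of the Kronecker sum of two Hermitian matrices are the sums of their
eigenvalues. -/
theorem roots_charpoly_kroneckerSum [DecidableEq m] [DecidableEq n] {A : Matrix m m ℝ}
    {B : Matrix n n ℝ} (hA : A.IsHermitian) (hB : B.IsHermitian) :
    (A ⊗ₖ (1 : Matrix n n ℝ) + (1 : Matrix m m ℝ) ⊗ₖ B).charpoly.roots =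
      (A.charpoly.roots ×ˢ B.charpoly.roots).map fun x => x.1 + x.2 := by
  let P : Matrix m m ℝ := (hA.eigenvectorUnitary : Matrix m m ℝ)
  let Q : Matrix n n ℝ := (hB.eigenvectorUnitary : Matrix n n ℝ)
  have hPP : P * star P = 1 := Unitary.coe_mul_star_self _
  have hQQ : Q * star Q = 1 := Unitary.coe_mul_star_self _
  have hPP' : star P * P = 1 := Unitary.coe_star_mul_self _
  have hQQ' : star Q * Q = 1 := Unitary.coe_star_mul_self _
  have eA : A = P * Matrix.diagonal hA.eigenvalues * star P := by
    conv_lhs => rw [hA.spectral_theorem, Unitary.conjStarAlgAut_apply]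
    rfl
  have eB : B = Q * Matrix.diagonal hB.eigenvalues * star Q := by
    conv_lhs => rw [hB.spectral_theorem, Unitary.conjStarAlgAut_apply]
    rfl
  have e : A ⊗ₖ (1 : Matrix n n ℝ) + (1 : Matrix m m ℝ) ⊗ₖ B =
      (P ⊗ₖ Q) * Matrix.diagonal (fun x : m × n => hA.eigenvalues x.1 + hB.eigenvalues x.2) *
        (star P ⊗ₖ star Q) := by
    have hdiag : Matrix.diagonal (fun x : m × n => hA.eigenvalues x.1 + hB.eigenvalues x.2) =
        Matrix.diagonal hA.eigenvalues ⊗ₖ (1 : Matrix n n ℝ) +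
          (1 : Matrix m m ℝ) ⊗ₖ Matrix.diagonal hB.eigenvalues := by
      simp only [← Matrix.diagonal_one, Matrix.diagonal_kronecker_diagonal, mul_one, one_mul,
        Matrix.diagonal_add]
    rw [hdiag, mul_add, add_mul, ← Matrix.mul_kronecker_mul, ← Matrix.mul_kronecker_mul,
      ← Matrix.mul_kronecker_mul, ← Matrix.mul_kronecker_mul, mul_one, mul_one, hPP, hQQ, ← eA,
      ← eB]
  rw [e, Matrix.charpoly_mul_comm, ← mul_assoc, ← Matrix.mul_kronecker_mul, hPP', hQQ',
    Matrix.one_kronecker_one, one_mul, Matrix.charpoly_diagonal, hA.roots_charpoly_eq_eigenvalues,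
    hB.roots_charpoly_eq_eigenvalues, Polynomial.roots_prod]
  · simp only [Polynomial.roots_X_sub_C, Multiset.bind_singleton]
    rw [← Finset.univ_product_univ, Finset.product_val]
    simp [SProd.sprod, Multiset.product, Multiset.map_bind, Multiset.bind_map]
  · exact Finset.prod_ne_zero_iff.2 fun x _ => Polynomial.X_sub_C_ne_zero _

lemma isHermitian_graphMatrix (M : MatrixKind) (G : SimpleGraph m) :
    (graphMatrix M G).IsHermitian := by
  classical
  cases M
  · exact G.isHermitian_adjMatrix ℝ
  · exact G.isHermitian_lapMatrix ℝ

open Classical in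
/-- The matrix of a Cartesian product is the Kronecker sum of the matrices of the factors. -/
lemma graphMatrix_boxProd (M : MatrixKind) (G : SimpleGraph m) (H : SimpleGraph n) :
    graphMatrix M (G □ H) =
      graphMatrix M G ⊗ₖ (1 : Matrix n n ℝ) + (1 : Matrix m m ℝ) ⊗ₖ graphMatrix M H := by
  have hadj : (G □ H).adjMatrix ℝ =
      G.adjMatrix ℝ ⊗ₖ (1 : Matrix n n ℝ) + (1 : Matrix m m ℝ) ⊗ₖ H.adjMatrix ℝ := by
    ext ⟨a, b⟩ ⟨a', b'⟩
    by_cases ha : a = a' <;> by_cases hb : b = b' <;>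
      simp [adjMatrix_apply, boxProd_adj, ha, hb]
  have hdeg : (G □ H).degMatrix ℝ =
      G.degMatrix ℝ ⊗ₖ (1 : Matrix n n ℝ) + (1 : Matrix m m ℝ) ⊗ₖ H.degMatrix ℝ := by
    simp only [degMatrix, ← Matrix.diagonal_one, Matrix.diagonal_kronecker_diagonal, mul_one,
      one_mul, Matrix.diagonal_add]
    congr 1
    funext x
    rw [← Nat.cast_add, degree_boxProd]
  cases M
  · simp only [graphMatrix]
    convert hadj
  · have : (G □ H).lapMatrix ℝ =
        G.lapMatrix ℝ ⊗ₖ (1 : Matrix n n ℝ) + (1 : Matrix m m ℝ) ⊗ₖ H.lapMatrix ℝ := by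
      rw [lapMatrix, hadj, hdeg]
      ext x y
      simp only [lapMatrix, Matrix.sub_apply, Matrix.add_apply, Matrix.kroneckerMap_apply]
      ring
    simp only [graphMatrix]
    convert this

/-- The spectrum of a Cartesian product consists of the sums of the eigenvalues of the factors. -/
theorem graphSpectrum_boxProd (M : MatrixKind) (G : SimpleGraph m) (H : SimpleGraph n) :
    graphSpectrum M (G □ H) =
      (graphSpectrum M G ×ˢ graphSpectrum M H).map fun x => x.1 + x.2 := by
  classical
  have h := roots_charpoly_kroneckerSum (isHermitian_graphMatrix M G)
    (isHermitian_graphMatrix M H)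
  unfold graphSpectrum
  rw [graphMatrix_boxProd]
  convert h

lemma card_graphSpectrum (M : MatrixKind) (G : SimpleGraph m) :
    (graphSpectrum M G).card = Nat.card m := by
  classical
  have h := (isHermitian_graphMatrix M G).roots_charpoly_eq_eigenvalues
  unfold graphSpectrum
  convert congrArg Multiset.card h
  simp

end Spectrum

/-! ### Rows and columns of the array of products -/

section Array

lemma card_filter_row_or_column {p q : ℕ} (a : Fin p) (b : Fin q) :
    (Finset.univ.filter fun x : Fin p × Fin q => x.1 = a ∨ x.2 = b).card = p + q - 1 := by
  have e₁ : (Finset.univ.filter fun x : Fin p × Fin q => x.1 = a) = {a} ×ˢ Finset.univ := by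
    ext ⟨i, j⟩; simp [eq_comm]
  have e₂ : (Finset.univ.filter fun x : Fin p × Fin q => x.2 = b) = Finset.univ ×ˢ {b} := by
    ext ⟨i, j⟩; simp [eq_comm]
  have e₃ : (Finset.univ.filter fun x : Fin p × Fin q => x.1 = a ∧ x.2 = b) = {(a, b)} := by
    ext; simp [Prod.ext_iff]
  have h := Finset.card_union_add_card_inter
    (Finset.univ.filter fun x : Fin p × Fin q => x.1 = a)
    (Finset.univ.filter fun x : Fin p × Fin q => x.2 = b)
  rw [← Finset.filter_or, ← Finset.filter_and, e₁, e₂, e₃] at h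
  simp only [Finset.card_product, Finset.card_singleton, Finset.card_univ, Fintype.card_fin,
    one_mul, mul_one] at h
  omega

variable {M : MatrixKind} {p q : ℕ} {V : Fin p → Type u} {W : Fin q → Type v}
  [∀ i, Fintype (V i)] [∀ j, Fintype (W j)]
  {G : ∀ i, SimpleGraph (V i)} {H : ∀ j, SimpleGraph (W j)}

lemma not_isomorphic_of_mem_row_or_column
    (hGconn : ∀ i, (G i).Connected) (hHconn : ∀ j, (H j).Connected)
    (hGcosp : ∀ i i', i ≠ i' → Cospectral M (G i) (G i'))
    (hHcosp : ∀ j j', j ≠ j' → Cospectral M (H j) (H j'))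
    {a : Fin p} {b : Fin q} (hab : CartesianCoprime (G a) (H b)) {x y : Fin p × Fin q}
    (hx : x.1 = a ∨ x.2 = b) (hy : y.1 = a ∨ y.2 = b) (hxy : x ≠ y) :
    ¬ Isomorphic (G x.1 □ H x.2) (G y.1 □ H y.2) := by
  have row {i j j'} (h : Isomorphic (G i □ H j) (G i □ H j')) : j = j' := by
    by_contra hne
    exact (hHcosp j j' hne).2 (isomorphic_of_boxProd_left h ((hGconn i).boxProd (hHconn j)))
  have column {i i' j} (h : Isomorphic (G i □ H j) (G i' □ H j)) : i = i' := by
    by_contra hne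
    exact (hGcosp i i' hne).2 <| isomorphic_of_boxProd_left
      ((Isomorphic.boxProd_comm _ _).trans (h.trans (Isomorphic.boxProd_comm _ _)))
      ((hHconn j).boxProd (hGconn i))
  have cross {i j} (h : Isomorphic (G a □ H j) (G i □ H b)) : i = a := by
    by_contra hne
    have hcosp := hGcosp a i (Ne.symm hne)
    refine hcosp.2 (hab.isomorphic_of_boxProd h ((hGconn a).boxProd (hHconn j)) ?_)
    rw [← card_graphSpectrum M (G a), hcosp.1, card_graphSpectrum]
  obtain ⟨i, j⟩ := x
  obtain ⟨i', j'⟩ := y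
  dsimp only at hx hy ⊢
  intro h
  refine hxy ?_
  rcases hx with rfl | rfl <;> rcases hy with rfl | rfl
  · rw [row h]
  · obtain rfl := cross h
    rw [row h]
  · obtain rfl := cross h.symm
    rw [row h]
  · rw [column h]

lemma graphSpectrum_boxProd_eq
    (hGcosp : ∀ i i', i ≠ i' → Cospectral M (G i) (G i'))
    (hHcosp : ∀ j j', j ≠ j' → Cospectral M (H j) (H j')) (i i' : Fin p) (j j' : Fin q) :
    graphSpectrum M (G i □ H j) = graphSpectrum M (G i' □ H j') := by
  have hG : graphSpectrum M (G i) = graphSpectrum M (G i') := by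
    by_cases h : i = i'
    · rw [h]
    · exact (hGcosp i i' h).1
  have hH : graphSpectrum M (H j) = graphSpectrum M (H j') := by
    by_cases h : j = j'
    · rw [h]
    · exact (hHcosp j j' h).1
  rw [graphSpectrum_boxProd, graphSpectrum_boxProd, hG, hH]

end Array

end CospectralProduct

open CospectralProduct in
theorem theorem2 (M : MatrixKind) (p q : ℕ)
    (V : Fin p → Type*) (W : Fin q → Type*)
    [∀ i, Fintype (V i)] [∀ j, Fintype (W j)]
    (G : ∀ i, SimpleGraph (V i)) (H : ∀ j, SimpleGraph (W j))
    (hGconn : ∀ i, (G i).Connected) (hHconn : ∀ j, (H j).Connected)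
    (hGcosp : ∀ i i', i ≠ i' → Cospectral M (G i) (G i'))
    (hHcosp : ∀ j j', j ≠ j' → Cospectral M (H j) (H j'))
    (hdiff : ∀ i j, graphSpectrum M (G i) ≠ graphSpectrum M (H j))
    (hcop : ∃ i j, CartesianCoprime (G i) (H j)) :
    -- the largest mutually non-isomorphic subfamily of the products has size at least `p + q - 1`
    (∃ m : ℕ,
      IsGreatest
        {k : ℕ | ∃ S : Finset (Fin p × Fin q), S.card = k ∧
          ∀ x ∈ S, ∀ y ∈ S, x ≠ y → ¬ Isomorphic (G x.1 □ H x.2) (G y.1 □ H y.2)} m ∧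
      p + q - 1 ≤ m) ∧
    -- and the column and row through any coprime pair form a connected cospectral family
    -- of that size
    (∀ a b, CartesianCoprime (G a) (H b) →
      ∃ S : Finset (Fin p × Fin q),
        (∀ x, x ∈ S ↔ x.1 = a ∨ x.2 = b) ∧
        S.card = p + q - 1 ∧
        (∀ x ∈ S, (G x.1 □ H x.2).Connected) ∧
        (∀ x ∈ S, ∀ y ∈ S, x ≠ y →
          Cospectral M (G x.1 □ H x.2) (G y.1 □ H y.2))) := by
  have main : ∀ a b, CartesianCoprime (G a) (H b) →
      ∃ S : Finset (Fin p × Fin q),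
        (∀ x, x ∈ S ↔ x.1 = a ∨ x.2 = b) ∧
        S.card = p + q - 1 ∧
        (∀ x ∈ S, (G x.1 □ H x.2).Connected) ∧
        (∀ x ∈ S, ∀ y ∈ S, x ≠ y →
          Cospectral M (G x.1 □ H x.2) (G y.1 □ H y.2)) := by
    intro a b hab
    refine ⟨Finset.univ.filter fun x => x.1 = a ∨ x.2 = b, by simp,
      card_filter_row_or_column a b, fun x _ => (hGconn _).boxProd (hHconn _), ?_⟩
    intro x hx y hy hxy
    exact ⟨graphSpectrum_boxProd_eq hGcosp hHcosp _ _ _ _,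
      not_isomorphic_of_mem_row_or_column hGconn hHconn hGcosp hHcosp hab
        (Finset.mem_filter.1 hx).2 (Finset.mem_filter.1 hy).2 hxy⟩
  refine ⟨?_, main⟩
  obtain ⟨a, b, hab⟩ := hcop
  obtain ⟨S, -, hcard, -, hS⟩ := main a b hab
  -- The set of sizes is bounded by the number of pairs, so it attains its supremum.
  set T := {k : ℕ | ∃ S : Finset (Fin p × Fin q), S.card = k ∧
    ∀ x ∈ S, ∀ y ∈ S, x ≠ y → ¬ Isomorphic (G x.1 □ H x.2) (G y.1 □ H y.2)}
  have hmem : p + q - 1 ∈ T := ⟨S, hcard, fun x hx y hy hxy => (hS x hx y hy hxy).2⟩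
  have hbdd : BddAbove T := by
    refine ⟨Fintype.card (Fin p × Fin q), ?_⟩
    rintro k ⟨S', rfl, -⟩
    exact S'.card_le_univ
  exact ⟨sSup T, ⟨Nat.sSup_mem ⟨_, hmem⟩ hbdd, fun k hk => le_csSup hbdd hk⟩, le_csSup hbdd hmem⟩
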